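/- Let $G$ be a locally compact Hausdorff group that is not compact, and let $X$ be a locally compact Hausdorff space with a continuous left action $G\times X\to X$, $(s,x)\mapsto s\cdot x$. Let $LUC(X,G)$ be the Banach space of all bounded continuous functions $F:X\to\mathbb C$ for which $s\mapsto l_sF$, where $l_sF(x)=F(s\cdot x)$, is continuous from $G$ into the bounded continuous functions on $X$ with the supremum norm, and let $LUC(G)=LUC(G,G)$ for the action of $G$ on itself by left multiplication. For $M\in LUC(X,G)^*$ and $F\in LUC(X,G)$ let $MF\in LUC(G)$ be the function $MF(s)=\langle M,l_sF\rangle$, and for $m\in LUC(G)^*$ define $m\cdot M\in LUC(X,G)^*$ by $\langle m\cdot M,F\rangle=\langle m,MF\rangle$. Let $$\mathfrak Z(X,G)=\{m\in LUC(G)^*:\ M\mapsto m\cdot M\ \text{is weak}^*\text{ to weak}^*\text{ continuous on } LUC(X,G)^*\},$$ and regard $M(G)$, the space of complex regular Borel measures on $G$, as a subset of $LUC(G)^*$ through $\langle\mu,f\rangle=\int_G f\,d\mu$. If $G$ does not act effectively on $X$, that is, if the subgroup $\{s\in G: s\cdot x=x\text{ for all }x\in X\}$ is not trivial, then $M(G)$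 is properly contained in $\mathfrak Z(X,G)$. -/

import Mathlib

open MeasureTheory Topology
open scoped BoundedContinuousFunction

noncomputable section

namespace GSpace

section Effective

variable (G X : Type*) [Group G] [MulAction G X]

/-- The subgroup `𝔑(X, G) = {s ∈ G : s • x = x for all x ∈ X}` of a group acting on `X`. -/
def actionKernel : Subgroup G where
  carrier := {s | ∀ x : X, s • x = x}
  one_mem' := fun x => one_smul G x
  mul_mem' := by
    intro a b ha hb x
    rw [mul_smul, hb x, ha x]
  inv_mem' := by
    intro a ha x
    rw [inv_smul_eq_iff, ha x]

/-- The action of `G` on `X` is effective when `𝔑(X, G)` is trivial. -/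
def ActsEffectively : Prop := actionKernel G X = ⊥

end Effective

section LUC

set_option linter.unusedSectionVars false

variable (G X : Type*) [Group G] [TopologicalSpace G] [IsTopologicalGroup G]
  [TopologicalSpace X] [MulAction G X] [ContinuousSMul G X]

variable {G X} in
/-- The left translate `(l_s F)(x) = F (s • x)` of a bounded continuous function. -/
def translate (s : G) (F : X →ᵇ ℂ) : X →ᵇ ℂ :=
  F.compContinuous ⟨fun x => s • x, continuous_const_smul s⟩

variable {G X} in
@[simp] theorem translate_apply (s : G) (F : X →ᵇ ℂ) (x : X) :
    translate s F x = F (s • x) := rfl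

variable {G X} in
theorem translate_add (s : G) (F F' : X →ᵇ ℂ) :
    translate s (F + F') = translate s F + translate s F' := rfl

variable {G X} in
theorem translate_smul (s : G) (c : ℂ) (F : X →ᵇ ℂ) :
    translate s (c • F) = c • translate s F := rfl

variable {G X} in
theorem translate_translate (s t : G) (F : X →ᵇ ℂ) :
    translate t (translate s F) = translate (s * t) F := by
  ext x
  simp [mul_smul]

variable {G X} in
theorem norm_translate_le (s : G) (F : X →ᵇ ℂ) : ‖translate s F‖ ≤ ‖F‖ :=
  (BoundedContinuousFunction.norm_le (norm_nonneg F)).2 fun x => F.norm_coe_le_norm (s • x)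

/-- `LUC(X, G)`: the bounded continuous complex functions `F` on `X` for which
`s ↦ l_s F` is continuous from `G` to `C_b(X)` with the supremum norm. The space `LUC(G)` of left
uniformly continuous functions on `G` is `LUC G G`, for the action of `G` on itself by left
multiplication. -/
def LUC : Submodule ℂ (X →ᵇ ℂ) where
  carrier := {F | Continuous fun s : G => translate s F}
  zero_mem' := (continuous_const : Continuous fun _ : G => (0 : X →ᵇ ℂ))
  add_mem' := by
    intro F F' hF hF'
    exact hF.add hF'
  smul_mem' := by
    intro c F hF
    exact hF.const_smul c

variable {G X}

/-- Left translation as a map of `LUC(X, G)` into itself. -/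
def lucTranslate (s : G) (F : LUC G X) : LUC G X :=
  ⟨translate s (F : X →ᵇ ℂ), by
    change Continuous fun t : G => translate t (translate s (F : X →ᵇ ℂ))
    simp only [translate_translate]
    exact F.2.comp (continuous_const_mul s)⟩

theorem continuous_lucTranslate (F : LUC G X) : Continuous fun s : G => lucTranslate s F :=
  F.2.subtype_mk _

theorem norm_lucTranslate_le (s : G) (F : LUC G X) : ‖lucTranslate s F‖ ≤ ‖F‖ :=
  norm_translate_le s (F : X →ᵇ ℂ)

theorem norm_dual_lucTranslate_le (M : StrongDual ℂ (LUC G X)) (F : LUC G X) (s : G) :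
    ‖M (lucTranslate s F)‖ ≤ ‖M‖ * ‖F‖ :=
  (M.le_opNorm _).trans
    (mul_le_mul_of_nonneg_left (norm_lucTranslate_le s F) (norm_nonneg M))

/-- The function `(M F)(s) = ⟨M, l_s F⟩` on `G`, as a bounded continuous function. -/
def orbitFunction (M : StrongDual ℂ (LUC G X)) (F : LUC G X) : G →ᵇ ℂ :=
  BoundedContinuousFunction.ofNormedAddCommGroup (fun s : G => M (lucTranslate s F))
    (M.continuous.comp (continuous_lucTranslate F)) (‖M‖ * ‖F‖) (norm_dual_lucTranslate_le M F)

theorem orbitFunction_mem (M : StrongDual ℂ (LUC G X)) (F : LUC G X) :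
    orbitFunction M F ∈ LUC G G := by
  change Continuous fun s : G => translate s (orbitFunction M F)
  have key : ∀ s : G, translate s (orbitFunction M F) = orbitFunction M (lucTranslate s F) := by
    intro s
    ext t
    change M (lucTranslate (s * t) F) = M (lucTranslate t (lucTranslate s F))
    congr 1
    exact Subtype.ext (translate_translate s t (F : X →ᵇ ℂ)).symm
  have hlip : LipschitzWith ‖M‖₊ (orbitFunction M) := by
    refine LipschitzWith.of_dist_le_mul fun F F' => ?_
    refine (BoundedContinuousFunction.dist_le (by positivity)).2 fun t => ?_
    change dist (M (lucTranslate t F)) (M (lucTranslate t F')) ≤ _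
    rw [dist_eq_norm, dist_eq_norm, ← map_sub]
    exact norm_dual_lucTranslate_le M (F - F') t
  simp only [key]
  exact hlip.continuous.comp (continuous_lucTranslate F)

/-- The bounded linear map `F ↦ M F` from `LUC(X, G)` to `LUC(G)`. -/
def orbitMap (M : StrongDual ℂ (LUC G X)) : LUC G X →L[ℂ] LUC G G :=
  LinearMap.mkContinuous
    { toFun := fun F => ⟨orbitFunction M F, orbitFunction_mem M F⟩
      map_add' := by
        intro F F'
        apply Subtype.ext
        ext s
        exact map_add M (lucTranslate s F) (lucTranslate s F')
      map_smul' := by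
        intro c F
        apply Subtype.ext
        ext s
        exact map_smul M c (lucTranslate s F) }
    ‖M‖
    (fun F => (BoundedContinuousFunction.norm_le
      (mul_nonneg (norm_nonneg M) (norm_nonneg F))).2 (norm_dual_lucTranslate_le M F))

/-- The module action `⟨m · M, F⟩ = ⟨m, M F⟩` of `LUC(G)^*` on `LUC(X, G)^*`. -/
def dualAction (m : StrongDual ℂ (LUC G G)) (M : StrongDual ℂ (LUC G X)) :
    StrongDual ℂ (LUC G X) :=
  m.comp (orbitMap M)

variable (G X)

/-- The topological centre `𝔷(X, G)`: the set of all `m ∈ LUC(G)^*` for which `M ↦ m · M` is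
weak-* to weak-* continuous on `LUC(X, G)^*`. -/
def topologicalCentre : Set (StrongDual ℂ (LUC G G)) :=
  {m | Continuous fun M : WeakDual ℂ (LUC G X) =>
    StrongDual.toWeakDual (dualAction m (WeakDual.toStrongDual M))}

/-- `M(G)` as a subset of `LUC(G)^*`: the functionals `f ↦ ∫ f dμ` where `μ` runs over the complex
Borel measures on `G` whose total variation measure is regular. -/
def measureFunctionals [MeasurableSpace G] : Set (StrongDual ℂ (LUC G G)) :=
  {m | ∃ μ : ComplexMeasure G, μ.variation.Regular ∧
    ∀ f : LUC G G,
      m f = VectorMeasure.integral μ (fun s : G => (f : G →ᵇ ℂ) s) (ContinuousLinearMap.mul ℝ ℂ)}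

end LUC

end GSpace

end

namespace GSpace

open Filter Set

/-! A measure `μ` lies in the centre because `⟨μ · M, F⟩ = ⟨M, ∫ l_s F dμ(s)⟩`: for each `F` this
evaluates `M` at one fixed element of `LUC(X, G)` (`apply_averageTranslate`). For properness take `n
≠ 1` acting trivially on `X`. Every `M F` is invariant under left translation by `n`, so a
functional `m` killing such functions has `m · M = 0` for all `M` and is in the centre. Let `m` be a
weak-* limit of `δ_s - δ_{ns}` as `s` leaves compact sets. It also kills functions of compact
support, so if it were a measure it would be zero (`eq_zero_of_mem_measureFunctionals`). It is
nonzero if `s` runs through a suitable unbounded set `S` (`exists_unbounded_separated`): with a bump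
`φ`, `φ 1 = 1`, the function `x ↦ sup_{t ∈ S} φ (x t⁻¹)` is in `LUC(G)`, equals `1` on `S` and `0`
on `nS`. -/

/-! ### Finite regular measures -/

theorem variation_univ_lt_top {α : Type*} [MeasurableSpace α] (μ : ComplexMeasure α) :
    μ.variation univ < ⊤ := by
  have h : μ.variation ≤ (ComplexMeasure.re μ).totalVariation +
      (ComplexMeasure.im μ).totalVariation := by
    refine VectorMeasure.variation_le_of_forall_enorm_le fun E _ => ?_
    have hre := (ComplexMeasure.re μ).enorm_le_totalVariation E
    have him := (ComplexMeasure.im μ).enorm_le_totalVariation E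
    refine le_trans ?_ (add_le_add hre him)
    have h1 : ‖μ E‖₊ ≤ ‖(μ E).re‖₊ + ‖(μ E).im‖₊ := Complex.norm_le_abs_re_add_abs_im (μ E)
    change (‖μ E‖₊ : ENNReal) ≤ (‖(μ E).re‖₊ : ENNReal) + (‖(μ E).im‖₊ : ENNReal)
    exact_mod_cast h1
  exact (h univ).trans_lt (measure_lt_top _ _)

instance isFiniteMeasure_variation {α : Type*} [MeasurableSpace α] (μ : ComplexMeasure α) :
    IsFiniteMeasure μ.variation := ⟨variation_univ_lt_top μ⟩

/-- A finite regular measure is carried by a compact set up to small mass. -/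
theorem exists_isCompact_measure_compl_lt {α : Type*} [TopologicalSpace α] [T2Space α]
    [MeasurableSpace α] [BorelSpace α] (ν : Measure α) [IsFiniteMeasure ν] [ν.Regular]
    {ε : ENNReal} (hε : ε ≠ 0) : ∃ K : Set α, IsCompact K ∧ ν Kᶜ < ε := by
  obtain ⟨K, -, hK, h⟩ := MeasurableSet.univ.exists_isCompact_sdiff_lt (measure_ne_top ν univ) hε
  exact ⟨K, hK, by rwa [compl_eq_univ_sdiff]⟩

/-- A continuous map into a metrizable space is almost everywhere strongly measurable for a finite
regular measure. -/
theorem aestronglyMeasurable_of_regular {α β : Type*} [TopologicalSpace α] [T2Space α]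
    [MeasurableSpace α] [BorelSpace α] [TopologicalSpace β] [TopologicalSpace.PseudoMetrizableSpace β]
    (ν : Measure α) [IsFiniteMeasure ν] [ν.Regular] {f : α → β} (hf : Continuous f) :
    AEStronglyMeasurable f ν := by
  -- Countably many compact sets carry `ν`; on each of them `f` has compact, hence separable, image.
  have hex : ∀ k : ℕ, ∃ K : Set α, IsCompact K ∧ ν Kᶜ < ((k : ENNReal) + 1)⁻¹ := fun k =>
    exists_isCompact_measure_compl_lt ν (by simp)
  choose K hK hν using hex
  have hnull : ν (⋃ k, K k)ᶜ = 0 := by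
    have hle : ∀ k : ℕ, ν (⋃ k, K k)ᶜ ≤ ((k : ENNReal) + 1)⁻¹ := fun k =>
      (measure_mono (compl_subset_compl.2 (subset_iUnion K k))).trans (hν k).le
    have hlim : Tendsto (fun k : ℕ => ((k : ENNReal) + 1)⁻¹) atTop (𝓝 0) := by
      have := (tendsto_add_atTop_iff_nat 1).2 ENNReal.tendsto_inv_nat_nhds_zero
      simpa using this
    exact le_antisymm (ge_of_tendsto' hlim hle) zero_le
  have hres : ν.restrict (⋃ k, K k) = ν := by
    rw [Measure.restrict_eq_self_of_ae_mem]
    exact hnull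
  rw [← hres, aestronglyMeasurable_iUnion_iff]
  exact fun k => hf.continuousOn.aestronglyMeasurable_of_isCompact (hK k) (hK k).measurableSet

/-! ### Suprema of right translates -/

section SupBounds

variable {G : Type*} [Group G] {φ : G → ℝ} {S : Set G}

/-- The supremum of the right translates by `S` of a function with values in `[0, 1]`. -/
noncomputable def supTranslates (φ : G → ℝ) (S : Set G) (x : G) : ℝ :=
  ⨆ s : S, φ (x * (s : G)⁻¹)

theorem bddAbove_translates (h1 : ∀ x, φ x ∈ Icc (0 : ℝ) 1) (x : G) :
    BddAbove (range fun s : S => φ (x * (s : G)⁻¹)) :=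
  ⟨1, by rintro _ ⟨s, rfl⟩; exact (h1 _).2⟩

theorem supTranslates_mem_Icc (h1 : ∀ x, φ x ∈ Icc (0 : ℝ) 1) (x : G) :
    supTranslates φ S x ∈ Icc (0 : ℝ) 1 :=
  ⟨Real.iSup_nonneg fun _ => (h1 _).1, Real.iSup_le (fun _ => (h1 _).2) zero_le_one⟩

theorem supTranslates_le_add (h1 : ∀ x, φ x ∈ Icc (0 : ℝ) 1) {ε : ℝ} (hε : 0 ≤ ε) {x y : G}
    (h : ∀ s : G, φ (x * s) ≤ φ (y * s) + ε) :
    supTranslates φ S x ≤ supTranslates φ S y + ε :=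
  -- The nonnegativity argument covers empty `S`, where the supremum is `0` by convention.
  Real.iSup_le (fun s => (h _).trans
    (add_le_add_left (le_ciSup (bddAbove_translates h1 y) s) ε))
    (add_nonneg (supTranslates_mem_Icc h1 y).1 hε)

end SupBounds

section Group

variable {G X : Type*} [Group G] [TopologicalSpace G] [IsTopologicalGroup G]
  [TopologicalSpace X] [MulAction G X] [ContinuousSMul G X]

/-! ### Measures belong to the topological centre -/

/-- Translations are contractions, so orbit maps converge uniformly. The resulting completeness is
what lets `averageTranslate` be a genuine vector-valued integral. -/
theorem isClosed_LUC : IsClosed (LUC G X : Set (X →ᵇ ℂ)) := by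
  refine isClosed_of_closure_subset fun F hF => ?_
  refine continuous_of_uniform_approx_of_continuous fun u hu => ?_
  obtain ⟨ε, hε, hu⟩ := Metric.mem_uniformity_dist.1 hu
  obtain ⟨F', hF', hd⟩ := Metric.mem_closure_iff.1 hF ε hε
  refine ⟨fun s => translate s F', hF', fun s => hu ?_⟩
  refine lt_of_le_of_lt ?_ hd
  rw [dist_eq_norm, dist_eq_norm]
  exact norm_translate_le s (F - F')

instance completeSpace_LUC : CompleteSpace (LUC G X) :=
  isClosed_LUC.completeSpace_coe

theorem integrable_lucTranslate [T2Space G] [MeasurableSpace G] [BorelSpace G] (ν : Measure G)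
    [IsFiniteMeasure ν] [ν.Regular] (F : LUC G X) :
    Integrable (fun s : G => lucTranslate s F) ν :=
  .of_bound (aestronglyMeasurable_of_regular ν (continuous_lucTranslate F)) ‖F‖
    (.of_forall fun s => norm_lucTranslate_le s F)

/-- The average `∫ l_s F dμ(s)` of the translates of `F`, as an element of `LUC(X, G)`. -/
noncomputable def averageTranslate [MeasurableSpace G] (μ : ComplexMeasure G) (F : LUC G X) :
    LUC G X :=
  VectorMeasure.integral μ (fun s : G => lucTranslate s F) (ContinuousLinearMap.lsmul ℝ ℂ).flip

theorem apply_averageTranslate [T2Space G] [MeasurableSpace G] [BorelSpace G]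
    (μ : ComplexMeasure G) [μ.variation.Regular] (M : StrongDual ℂ (LUC G X)) (F : LUC G X) :
    M (averageTranslate μ F) = VectorMeasure.integral μ (fun s : G => M (lucTranslate s F))
      (ContinuousLinearMap.mul ℝ ℂ) := by
  have hint := integrable_lucTranslate μ.variation F
  have h1 := VectorMeasure.continuousLinearMap_apply_integral (μ := μ)
    (B := (ContinuousLinearMap.lsmul ℝ ℂ).flip) (C := M.restrictScalars ℝ) hint
  have h2 := VectorMeasure.integral_continuousLinearMap_comp (μ := μ)
    (B := ContinuousLinearMap.mul ℝ ℂ) (C := M.restrictScalars ℝ) hint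
  refine h1.trans (Eq.trans ?_ h2.symm)
  congr 1
  ext F'; simp [mul_comm]

theorem measureFunctionals_subset_topologicalCentre [T2Space G] [MeasurableSpace G]
    [BorelSpace G] : measureFunctionals G ⊆ topologicalCentre G X := by
  rintro m ⟨μ, hμ, hm⟩
  refine WeakDual.continuous_of_continuous_eval fun F => ?_
  have key : ∀ M : WeakDual ℂ (LUC G X),
      StrongDual.toWeakDual (dualAction m (WeakDual.toStrongDual M)) F
        = M (averageTranslate μ F) := fun M =>
    (hm (orbitMap (WeakDual.toStrongDual M) F)).trans
      (apply_averageTranslate μ (WeakDual.toStrongDual M) F).symm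
  simp only [key]
  exact WeakDual.eval_continuous _

/-! ### Constructing elements of `LUC(G)` -/

/-- A bounded continuous function on `G` is in `LUC(G)` as soon as its left translates vary
continuously at the identity. -/
theorem mem_LUC_of_eventually {F : G →ᵇ ℂ}
    (h : ∀ ε > 0, ∀ᶠ t in 𝓝 (1 : G), ∀ x, ‖F (t * x) - F x‖ ≤ ε) : F ∈ LUC G G := by
  change Continuous fun s : G => translate s F
  refine continuous_iff_continuousAt.2 fun s => Metric.tendsto_nhds.2 fun ε hε => ?_
  have hlim : Tendsto (fun t : G => t * s⁻¹) (𝓝 s) (𝓝 1) := by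
    have : Continuous fun t : G => t * s⁻¹ := by fun_prop
    simpa using this.tendsto s
  filter_upwards [hlim.eventually (h (ε / 2) (half_pos hε))] with t ht
  refine lt_of_le_of_lt ?_ (half_lt_self hε)
  refine (BoundedContinuousFunction.dist_le (half_pos hε).le).2 fun x => ?_
  simpa [dist_eq_norm, mul_assoc] using ht (s * x)

/-- A continuous function of compact support on a group is uniformly continuous under small left
translations. -/
theorem eventually_norm_mul_sub_le {E : Type*} [NormedAddCommGroup E] {φ : G → E}
    (hφ : Continuous φ) (hc : HasCompactSupport φ) {ε : ℝ} (hε : 0 < ε) :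
    ∀ᶠ t in 𝓝 (1 : G), ∀ x, ‖φ (t * x) - φ x‖ ≤ ε := by
  -- In this uniformity `(x, y)` is small when `y x⁻¹` is near `1`, as for `y = t x`.
  let := IsTopologicalGroup.rightUniformSpace G
  have hu := hc.uniformContinuous_of_continuous hφ
  have h := hu (Metric.dist_mem_uniformity hε)
  rw [mem_map, uniformity_eq_comap_nhds_one', mem_comap] at h
  obtain ⟨V, hV, hVs⟩ := h
  filter_upwards [hV] with t ht x
  have : ((x, t * x) : G × G) ∈ (fun p : G × G => (φ p.1, φ p.2)) ⁻¹' {p | dist p.1 p.2 < ε} :=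
    hVs (by simpa using ht)
  rw [← dist_eq_norm, dist_comm]
  exact le_of_lt this

theorem mem_LUC_of_hasCompactSupport {F : G →ᵇ ℂ} (hF : HasCompactSupport F) : F ∈ LUC G G :=
  mem_LUC_of_eventually fun _ hε => eventually_norm_mul_sub_le F.continuous hF hε

section SupTranslates

variable {φ : G → ℝ} {S : Set G}

/-- Left and right translations commute, so all right translates of `φ` share one modulus of
continuity, which passes to the supremum. -/
theorem eventually_supTranslates (hφ : Continuous φ) (hc : HasCompactSupport φ)
    (h1 : ∀ x, φ x ∈ Icc (0 : ℝ) 1) {ε : ℝ} (hε : 0 < ε) :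
    ∀ᶠ t in 𝓝 (1 : G), ∀ x, |supTranslates φ S (t * x) - supTranslates φ S x| ≤ ε := by
  filter_upwards [eventually_norm_mul_sub_le hφ hc hε] with t ht x
  have h : ∀ s : G, |φ (t * x * s) - φ (x * s)| ≤ ε := fun s => by
    simpa [mul_assoc] using ht (x * s)
  have ha := supTranslates_le_add (S := S) (x := t * x) (y := x) h1 hε.le
    fun s => by linarith [(abs_le.1 (h s)).2]
  have hb := supTranslates_le_add (S := S) (x := x) (y := t * x) h1 hε.le
    fun s => by linarith [(abs_le.1 (h s)).1]
  exact abs_le.2 ⟨by linarith, by linarith⟩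

theorem continuous_supTranslates (hφ : Continuous φ) (hc : HasCompactSupport φ)
    (h1 : ∀ x, φ x ∈ Icc (0 : ℝ) 1) : Continuous (supTranslates φ S) := by
  refine continuous_iff_continuousAt.2 fun x => Metric.tendsto_nhds.2 fun ε hε => ?_
  have hlim : Tendsto (fun t : G => t * x⁻¹) (𝓝 x) (𝓝 1) := by
    have : Continuous fun t : G => t * x⁻¹ := by fun_prop
    simpa using this.tendsto x
  filter_upwards [hlim.eventually (eventually_supTranslates hφ hc h1 (half_pos hε))] with t ht
  have := ht x
  rw [inv_mul_cancel_right] at this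
  exact lt_of_le_of_lt this (half_lt_self hε)

/-- The supremum of right translates as an element of `LUC(G)`. -/
theorem exists_LUC_eq_supTranslates (hφ : Continuous φ) (hc : HasCompactSupport φ)
    (h1 : ∀ x, φ x ∈ Icc (0 : ℝ) 1) :
    ∃ f : LUC G G, ∀ x, (f : G →ᵇ ℂ) x = (supTranslates φ S x : ℂ) := by
  refine ⟨⟨BoundedContinuousFunction.ofNormedAddCommGroup
    (fun x => (supTranslates φ S x : ℂ))
    (Complex.continuous_ofReal.comp (continuous_supTranslates hφ hc h1)) 1 fun x => ?_,
    mem_LUC_of_eventually fun ε hε => ?_⟩, fun x => rfl⟩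
  · obtain ⟨h0, h1⟩ := supTranslates_mem_Icc (S := S) h1 x
    rw [Complex.norm_real, Real.norm_eq_abs]
    exact abs_le.2 ⟨by linarith, h1⟩
  · filter_upwards [eventually_supTranslates (S := S) hφ hc h1 hε] with t ht x
    change ‖(supTranslates φ S (t * x) : ℂ) - (supTranslates φ S x : ℂ)‖ ≤ ε
    rw [← Complex.ofReal_sub, Complex.norm_real]
    exact ht x

end SupTranslates

/-! ### A functional in the centre that is not a measure -/

/-- In a noncompact group, if `φ` has compact support and vanishes at `n`, some set `S` which is
contained in no compact set satisfies `φ (n s t⁻¹) = 0` for all `s, t ∈ S`. -/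
theorem exists_unbounded_separated [NoncompactSpace G] {φ : G → ℝ} (hc : HasCompactSupport φ)
    {n : G} (hn : φ n = 0) :
    ∃ S : Set G, (∀ s ∈ S, ∀ t ∈ S, φ (n * s * t⁻¹) = 0) ∧
      ∀ K : Set G, IsCompact K → ¬ S ⊆ K := by
  obtain ⟨S, hS⟩ := zorn_subset {S : Set G | ∀ s ∈ S, ∀ t ∈ S, φ (n * s * t⁻¹) = 0} (by
    intro c hcS hchain
    refine ⟨⋃₀ c, ?_, fun s hs => subset_sUnion_of_mem hs⟩
    rintro s ⟨A, hA, hsA⟩ t ⟨B, hB, htB⟩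
    rcases hchain.total hA hB with h | h
    · exact hcS hB s (h hsA) t htB
    · exact hcS hA s hsA t (h htB))
  refine ⟨S, hS.prop, fun K hK hSK => ?_⟩
  have hT : IsCompact (tsupport φ) := hc
  refine noncompact_univ G ?_
  let A : G × G → G := fun p => n⁻¹ * p.1 * p.2
  let B : G × G → G := fun p => p.1⁻¹ * n * p.2
  have hA : IsCompact (A '' (tsupport φ ×ˢ K)) :=
    (hT.prod hK).image (by fun_prop)
  have hB : IsCompact (B '' (tsupport φ ×ˢ K)) :=
    (hT.prod hK).image (by fun_prop)
  -- A point outside these three compact sets could be added to the maximal `S`; so they would cover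
  -- `G`.
  have hcov : univ ⊆ K ∪ A '' (tsupport φ ×ˢ K) ∪ B '' (tsupport φ ×ˢ K) := by
    intro x _
    by_contra hx
    simp only [mem_union, not_or] at hx
    obtain ⟨⟨hxK, hxA⟩, hxB⟩ := hx
    have hA' : ∀ s ∈ S, φ (n * x * s⁻¹) = 0 := fun s hs => by
      by_contra h
      exact hxA ⟨(n * x * s⁻¹, s), ⟨subset_tsupport φ h, hSK hs⟩, by simp [A, mul_assoc]⟩
    have hB' : ∀ s ∈ S, φ (n * s * x⁻¹) = 0 := fun s hs => by
      by_contra h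
      exact hxB ⟨(n * s * x⁻¹, s), ⟨subset_tsupport φ h, hSK hs⟩, by simp [B, mul_assoc]⟩
    have hins : insert x S ∈ {S : Set G | ∀ s ∈ S, ∀ t ∈ S, φ (n * s * t⁻¹) = 0} := by
      rintro s (rfl | hs) t (rfl | ht)
      · simpa using hn
      · exact hA' t ht
      · exact hB' s hs
      · exact hS.prop s hs t ht
    exact hxK (hSK (hS.le_of_ge hins (subset_insert x S) (mem_insert x S)))
  rw [← univ_subset_iff.1 hcov]
  exact (hK.union hA).union hB

/-- Evaluation at a point of `G`, as a functional on `LUC(G)`. -/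
noncomputable def evalFunctional (s : G) : StrongDual ℂ (LUC G G) :=
  (BoundedContinuousFunction.evalCLM ℂ s).comp (LUC G G).subtypeL

@[simp] theorem evalFunctional_apply (s : G) (f : LUC G G) :
    evalFunctional s f = (f : G →ᵇ ℂ) s := rfl

/-- Differences of evaluations at `s` and `n s` have a weak-* limit along every ultrafilter. -/
theorem exists_tendsto_eval_sub (n : G) (U : Ultrafilter G) :
    ∃ m : StrongDual ℂ (LUC G G), ∀ f : LUC G G,
      Tendsto (fun s => (f : G →ᵇ ℂ) s - (f : G →ᵇ ℂ) (n * s)) U (𝓝 (m f)) := by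
  let D : G → WeakDual ℂ (LUC G G) := fun s =>
    StrongDual.toWeakDual (evalFunctional s - evalFunctional (n * s))
  have hD : ∀ s, D s ∈ WeakDual.toStrongDual ⁻¹'
      Metric.closedBall (0 : StrongDual ℂ (LUC G G)) 2 := fun s => by
    refine (dist_zero_right (evalFunctional s - evalFunctional (n * s))).trans_le ?_
    refine ContinuousLinearMap.opNorm_le_bound _ zero_le_two fun f => ?_
    change ‖(f : G →ᵇ ℂ) s - (f : G →ᵇ ℂ) (n * s)‖ ≤ 2 * ‖(f : G →ᵇ ℂ)‖
    rw [two_mul]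
    exact (norm_sub_le _ _).trans (add_le_add ((f : G →ᵇ ℂ).norm_coe_le_norm _)
      ((f : G →ᵇ ℂ).norm_coe_le_norm _))
  obtain ⟨m, -, hm⟩ := (WeakDual.isCompact_closedBall (0 : StrongDual ℂ (LUC G G)) 2
    ).ultrafilter_le_nhds (U.map D) (le_principal_iff.2 (mem_map.2 (Eventually.of_forall hD)))
  exact ⟨WeakDual.toStrongDual m, fun f =>
    ((WeakDual.eval_continuous f).tendsto m).comp (show Tendsto D U (𝓝 m) from hm)⟩

/-- A function in `LUC(G)` may be cut off by a continuous function of compact support. -/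
theorem exists_LUC_eq_mul (f : LUC G G) {ψ : G → ℝ} (hψ : Continuous ψ) (hψc : HasCompactSupport ψ)
    (hψ01 : ∀ x, ψ x ∈ Icc (0 : ℝ) 1) :
    ∃ g : LUC G G, HasCompactSupport (g : G →ᵇ ℂ) ∧
      ∀ x, (g : G →ᵇ ℂ) x = (f : G →ᵇ ℂ) x * (ψ x : ℂ) := by
  have hle : ∀ x, ‖(f : G →ᵇ ℂ) x * (ψ x : ℂ)‖ ≤ ‖f‖ := fun x => by
    rw [norm_mul, Complex.norm_real, Real.norm_eq_abs, abs_of_nonneg (hψ01 x).1]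
    exact (mul_le_of_le_one_right (norm_nonneg _) (hψ01 x).2).trans
      ((f : G →ᵇ ℂ).norm_coe_le_norm x)
  let g : G →ᵇ ℂ := BoundedContinuousFunction.ofNormedAddCommGroup
    (fun x => (f : G →ᵇ ℂ) x * (ψ x : ℂ)) (by fun_prop) ‖f‖ hle
  have hg : HasCompactSupport g :=
    (hψc.comp_left (g := fun r : ℝ => (r : ℂ)) Complex.ofReal_zero).mul_left
  exact ⟨⟨g, mem_LUC_of_hasCompactSupport hg⟩, hg, fun _ => rfl⟩

/-- A functional given by a regular complex measure vanishes once it kills the functions of compact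
support. -/
theorem eq_zero_of_mem_measureFunctionals [T2Space G] [LocallyCompactSpace G] [MeasurableSpace G]
    [BorelSpace G] {m : StrongDual ℂ (LUC G G)} (hm : m ∈ measureFunctionals G)
    (h0 : ∀ f : LUC G G, HasCompactSupport (f : G →ᵇ ℂ) → m f = 0) : m = 0 := by
  obtain ⟨μ, hμ, hm⟩ := hm
  refine ContinuousLinearMap.ext fun f => ?_
  have hb : ∀ ε : ℝ, 0 < ε → ‖m f‖ ≤ ‖f‖ * ε := by
    intro ε hε
    obtain ⟨K, hK, hKε⟩ := exists_isCompact_measure_compl_lt μ.variation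
      (ENNReal.ofReal_pos.2 hε).ne'
    obtain ⟨ψ, hψ1, -, hψc, hψ01⟩ := exists_continuous_one_zero_of_isCompact hK isClosed_empty
      (disjoint_empty K)
    obtain ⟨g, hgc, hg⟩ := exists_LUC_eq_mul f ψ.continuous hψc hψ01
    -- `f - g = f (1 - ψ)` vanishes on `K`, so only the small mass of `Kᶜ` contributes.
    have hsub : m f = m (f - g) := by rw [map_sub, h0 g hgc, sub_zero]
    have hpt : ∀ x, ‖((f - g : LUC G G) : G →ᵇ ℂ) x‖ ≤ Kᶜ.indicator (fun _ => ‖f‖) x := by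
      intro x
      have hx : ((f - g : LUC G G) : G →ᵇ ℂ) x = (f : G →ᵇ ℂ) x * ((1 - ψ x : ℝ) : ℂ) := by
        change (f : G →ᵇ ℂ) x - (g : G →ᵇ ℂ) x = _
        rw [hg x]
        push_cast
        ring
      rw [hx, norm_mul, Complex.norm_real, Real.norm_eq_abs,
        abs_of_nonneg (sub_nonneg.2 (hψ01 x).2)]
      by_cases hxK : x ∈ K
      · have hx1 : ψ x = 1 := hψ1 hxK
        rw [indicator_of_notMem (notMem_compl_iff.2 hxK), hx1, sub_self, mul_zero]
      · rw [indicator_of_mem (mem_compl hxK)]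
        exact (mul_le_of_le_one_right (norm_nonneg _) (sub_le_self 1 (hψ01 x).1)).trans
          ((f : G →ᵇ ℂ).norm_coe_le_norm x)
    have hKm : MeasurableSet Kᶜ := hK.measurableSet.compl
    rw [hsub, hm (f - g)]
    calc _ ≤ ∫ x, ‖((f - g : LUC G G) : G →ᵇ ℂ) x‖ ∂μ.variation :=
          VectorMeasure.norm_integral_le_integral_norm.trans
            (mul_le_of_le_one_left (integral_nonneg fun _ => norm_nonneg _)
              (ContinuousLinearMap.opNorm_mul_le ℝ ℂ))
      _ ≤ ∫ x, Kᶜ.indicator (fun _ => ‖f‖) x ∂μ.variation :=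
          integral_mono_of_nonneg (.of_forall fun _ => norm_nonneg _)
            ((integrable_const _).indicator hKm) (.of_forall hpt)
      _ = ‖f‖ * μ.variation.real Kᶜ := by
          rw [integral_indicator_const _ hKm, smul_eq_mul, mul_comm]
      _ ≤ ‖f‖ * ε := mul_le_mul_of_nonneg_left
          (ENNReal.toReal_le_of_le_ofReal hε.le hKε.le) (norm_nonneg _)
  have hlim : Tendsto (fun ε : ℝ => ‖f‖ * ε) (𝓝[>] 0) (𝓝 0) := by
    have h := (continuous_const_mul ‖f‖).tendsto 0
    rw [mul_zero] at h
    exact h.mono_left nhdsWithin_le_nhds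
  exact norm_le_zero_iff.1 (ge_of_tendsto hlim (eventually_nhdsWithin_of_forall hb))

/-- For `n ≠ 1` in a noncompact group there is a nonzero functional which kills the functions of
compact support and the functions invariant under left translation by `n`. -/
theorem exists_functional_ne_zero [T2Space G] [LocallyCompactSpace G] [NoncompactSpace G] {n : G}
    (hn : n ≠ 1) :
    ∃ m : StrongDual ℂ (LUC G G), m ≠ 0 ∧
      (∀ f : LUC G G, HasCompactSupport (f : G →ᵇ ℂ) → m f = 0) ∧
      ∀ f : LUC G G, (∀ s, (f : G →ᵇ ℂ) (n * s) = (f : G →ᵇ ℂ) s) → m f = 0 := by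
  obtain ⟨φ, hφ1, hφn, hφc, hφ01⟩ := exists_continuous_one_zero_of_isCompact
    (isCompact_singleton (x := (1 : G))) (isClosed_singleton (x := n))
    (disjoint_singleton.2 hn.symm)
  replace hφ1 : φ 1 = 1 := hφ1 rfl
  replace hφn : φ n = 0 := hφn rfl
  obtain ⟨S, hS, hSK⟩ := exists_unbounded_separated hφc hφn
  have hne : (cocompact G ⊓ 𝓟 S).NeBot := by
    refine inf_principal_neBot_iff.2 fun A hA => ?_
    obtain ⟨K, hK, hKA⟩ := mem_cocompact.1 hA
    obtain ⟨x, hxS, hxK⟩ := not_subset.1 (hSK K hK)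
    exact ⟨x, hKA hxK, hxS⟩
  -- `U` contains `S`, which makes `m` nonzero, and escapes every compact set, which makes `m` kill
  -- compactly supported functions.
  let U := Ultrafilter.of (cocompact G ⊓ 𝓟 S)
  have hU : (U : Filter G) ≤ cocompact G ⊓ 𝓟 S := Ultrafilter.of_le _
  have hUS : ∀ᶠ s in (U : Filter G), s ∈ S := le_principal_iff.1 (hU.trans inf_le_right)
  obtain ⟨m, hm⟩ := exists_tendsto_eval_sub n U
  refine ⟨m, ?_, fun f hf => ?_, fun f hf => ?_⟩
  · obtain ⟨f, hf⟩ := exists_LUC_eq_supTranslates (S := S) φ.continuous hφc hφ01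
    have hone : ∀ s ∈ S, supTranslates φ S s = 1 := fun s hs => by
      refine le_antisymm (supTranslates_mem_Icc hφ01 s).2 ?_
      have := le_ciSup (bddAbove_translates (S := S) hφ01 s) ⟨s, hs⟩
      rwa [mul_inv_cancel, hφ1] at this
    have hzero : ∀ s ∈ S, supTranslates φ S (n * s) = 0 := fun s hs => by
      simp only [supTranslates, hS s hs _ (Subtype.coe_prop _), Real.iSup_const_zero]
    have hlim : Tendsto (fun s => (f : G →ᵇ ℂ) s - (f : G →ᵇ ℂ) (n * s)) U (𝓝 1) := by
      refine tendsto_const_nhds.congr' ?_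
      filter_upwards [hUS] with s hs
      simp [hf, hone s hs, hzero s hs]
    have hmf : m f = 1 := tendsto_nhds_unique (hm f) hlim
    rintro rfl
    simp at hmf
  · have hfU : ∀ᶠ s in (U : Filter G), (f : G →ᵇ ℂ) s = 0 ∧ (f : G →ᵇ ℂ) (n * s) = 0 := by
      refine (hU.trans inf_le_left) ?_
      have h1 : ∀ᶠ s in cocompact G, (f : G →ᵇ ℂ) s = 0 := by
        filter_upwards [hf.isCompact.compl_mem_cocompact] with s hs
        exact image_eq_zero_of_notMem_tsupport hs
      exact h1.and ((Homeomorph.mulLeft n).isClosedEmbedding.tendsto_cocompact.eventually h1)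
    refine tendsto_nhds_unique (hm f) (tendsto_const_nhds.congr' ?_)
    filter_upwards [hfU] with s hs
    simp [hs.1, hs.2]
  · exact tendsto_nhds_unique (hm f) (by simp [hf])

/-- Since `n` fixes the point `s • x`, the translates of `F` by `n * s` and by `s` coincide. -/
theorem orbitMap_mul_apply_of_mem_actionKernel {n : G} (hn : n ∈ actionKernel G X)
    (M : StrongDual ℂ (LUC G X)) (F : LUC G X) (s : G) :
    (orbitMap M F : G →ᵇ ℂ) (n * s) = (orbitMap M F : G →ᵇ ℂ) s := by
  change M (lucTranslate (n * s) F) = M (lucTranslate s F)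
  congr 1
  refine Subtype.ext (BoundedContinuousFunction.ext fun x => ?_)
  change (F : X →ᵇ ℂ) ((n * s) • x) = (F : X →ᵇ ℂ) (s • x)
  rw [mul_smul, hn (s • x)]

end Group

end GSpace

theorem corollary500 {G X : Type*}
    [Group G] [TopologicalSpace G] [IsTopologicalGroup G] [T2Space G] [LocallyCompactSpace G]
    [NoncompactSpace G] [MeasurableSpace G] [BorelSpace G]
    [TopologicalSpace X] [T2Space X] [LocallyCompactSpace X]
    [MulAction G X] [ContinuousSMul G X]
    (hne : ¬ GSpace.ActsEffectively G X) :
    GSpace.measureFunctionals G ⊂ GSpace.topologicalCentre G X := by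
  refine ⟨GSpace.measureFunctionals_subset_topologicalCentre, fun hsub => ?_⟩
  obtain ⟨n, hn, hn1⟩ : ∃ n ∈ GSpace.actionKernel G X, n ≠ 1 :=
    (Subgroup.bot_or_exists_ne_one _).resolve_left hne
  obtain ⟨m, hm0, hmc, hminv⟩ := GSpace.exists_functional_ne_zero hn1
  refine hm0 (GSpace.eq_zero_of_mem_measureFunctionals (hsub ?_) hmc)
  refine WeakDual.continuous_of_continuous_eval fun F => ?_
  have key : ∀ M : WeakDual ℂ (GSpace.LUC G X), StrongDual.toWeakDual
      (GSpace.dualAction m (WeakDual.toStrongDual M)) F = 0 := fun M =>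
    hminv _ (GSpace.orbitMap_mul_apply_of_mem_actionKernel hn _ F)
  simp only [key]
  exact continuous_const
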